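/- Call a set $S\subseteq\mathbb{Z}^2$ sum-free if there are no (not necessarily distinct) $a,b,c\in S$ with $a+b=c$, addition being coordinatewise. For a positive integer $n$, let $R_0=R_0(n)$ be the set of lattice points $(x,y)\in\mathbb{Z}^2\cap[0,n]^2$ with $0.7n\le x+y\le 1.7n$. Then the number of sum-free subsets of $R_0(n)$ is at most $2^{0.6n^2+O(n)}$; that is, there is an absolute constant $C$ such that for every $n\ge 1$ the number of sum-free subsets of $R_0(n)$ is at most $2^{0.6n^2+Cn}$. -/

import Mathlib

/-- A set `S` is sum-free if there are no (not necessarily distinct) `a, b, c ∈ S`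
with `a + b = c`. -/
def IsSumFreeSet {G : Type*} [AddCommGroup G] (S : Set G) : Prop :=
  ∀ a ∈ S, ∀ b ∈ S, ∀ c ∈ S, a + b ≠ c

/-- The set `Λ(R)` of lattice points (points of `ℤ²`) of a planar region `R`. -/
def latticePoints (R : Set (ℝ × ℝ)) : Set (ℤ × ℤ) :=
  {p | ((p.1 : ℝ), (p.2 : ℝ)) ∈ R}

/-- The number of sum-free subsets of a finite set `R`. -/
noncomputable def sumFreeCount {G : Type*} [AddCommGroup G] (R : Set G) : ℕ :=
  {S : Set G | S ⊆ R ∧ IsSumFreeSet S}.ncard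

/-- The region `{(x, y) ∈ [0, n]² : 0.7 n ≤ x + y ≤ 1.7 n}`. -/
def regionR0 (n : ℕ) : Set (ℝ × ℝ) :=
  {p | p.1 ∈ Set.Icc (0 : ℝ) n ∧ p.2 ∈ Set.Icc (0 : ℝ) n ∧
    0.7 * (n : ℝ) ≤ p.1 + p.2 ∧ p.1 + p.2 ≤ 1.7 * (n : ℝ)}

/-- The set of lattice points of `regionR0 n` is finite. -/
theorem latticePoints_regionR0_finite (n : ℕ) : (latticePoints (regionR0 n)).Finite := by
  refine (Set.finite_Icc ((0 : ℤ), (0 : ℤ)) ((n : ℤ), (n : ℤ))).subset ?_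
  rintro ⟨x, y⟩ ⟨⟨hx0, hx1⟩, ⟨hy0, hy1⟩, -⟩
  simp only at hx0 hx1 hy0 hy1
  have h1 : 0 ≤ x := by exact_mod_cast hx0
  have h2 : 0 ≤ y := by exact_mod_cast hy0
  have h3 : x ≤ n := by exact_mod_cast hx1
  have h4 : y ≤ n := by exact_mod_cast hy1
  exact ⟨⟨h1, h2⟩, ⟨h3, h4⟩⟩

/-- For finite `R` the family counted by `sumFreeCount` is finite, so that `sumFreeCount R`
is its actual cardinality. -/
theorem sumFreeSubsets_finite {G : Type*} [AddCommGroup G] {R : Set G} (hR : R.Finite) :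
    {S : Set G | S ⊆ R ∧ IsSumFreeSet S}.Finite :=
  hR.finite_subsets.subset fun _ hS => hS.1

/-!
Put `t = 0.7 n`. Inside the strip `t ≤ x + y < t + L`, where `L ≈ 0.3 n`, pair the column over
`x₀ + j` with the column over `y₀ + j`, for `j < k + 2`. The sumsets of the columns over `x₀ + j`
and `y₀ + j'` with `(j, j') = (e + 1, e + 1)`, `(e + 2, e)` and `(e, e + 2)` all lie over
`x₀ + y₀ + 2 (e + 1)`, and a sum-free set avoids the three of them in the strip
`2 t ≤ x + y < 2 t + L`. Its trace on all these columns therefore takes at most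
`∑ Z, ∏ e, 2 ^ |U_e|` values, where `Z` ranges over the possible traces on the pairs and `U_e` is
the part of the `e`-th upper column left free. Hölder's inequality with exponent `3` splits this sum
into sums of `8 ^ |U_e|` over triples of consecutive pairs.

Write `8 ^ |U|` as the sum of `7 ^ |D|` over `D ⊆ U` and let `T = max D`. If `V` and `W` have minima
`α` and `β` and `V + W` misses `D`, then `c - β ∈ V` excludes both `T + β - c ∈ W` and `c ∈ D`. So
each position between `α + β` and `T` costs a constant factor, and so does each position between `T`
and `α + β`, since nothing of `V` and `W` lies below the minima. Up to geometrically decaying terms,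
the three sums of minima thus agree with `T` and with each other, and each further pair of columns
has only boundedly many choices for its two minima. Hence there are at most `2 ^ (2 k L + O(k + L))`
traces.

Finally, with `q = n / 10`, two chains with `k ≈ 2 q` and `L ≈ 3 q` contribute `12 q²` each to the
exponent, and `36 q² + O(q)` points remain; in total `60 q² ≤ 0.6 n²`.
-/

section

open Finset
open scoped NNReal Pointwise

lemma sum_powerset_prod_decide_mem {ι α K : Type*} [DecidableEq α] [Semifield K] [CharZero K]
    {s : Finset α} {I : Finset ι} {σ : ι → α} (hσ : Set.InjOn σ I) (hs : ∀ c ∈ I, σ c ∈ s)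
    (g : ι → Bool → K) :
    ∑ V ∈ s.powerset, ∏ c ∈ I, g c (decide (σ c ∈ V)) =
      2 ^ #s * ∏ c ∈ I, (g c true + g c false) / 2 := by
  classical
  induction I using Finset.induction_on generalizing s with
  | empty => simp
  | insert c I hc ih =>
    have hcs : σ c ∈ s := hs c (mem_insert_self _ _)
    have hne : ∀ d ∈ I, σ d ≠ σ c := fun d hd h =>
      hc (hσ (by simp [hd]) (by simp) h ▸ hd)
    have hI : ∀ d ∈ I, σ d ∈ s.erase (σ c) := fun d hd =>
      mem_erase.2 ⟨hne d hd, hs d (mem_insert_of_mem hd)⟩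
    have without : ∀ V ∈ (s.erase (σ c)).powerset,
        ∏ d ∈ insert c I, g d (decide (σ d ∈ V)) =
          g c false * ∏ d ∈ I, g d (decide (σ d ∈ V)) := fun V hV => by
      have : σ c ∉ V := fun h => notMem_erase _ _ (mem_powerset.1 hV h)
      rw [prod_insert hc, decide_eq_false this]
    have containing : ∀ V ∈ (s.erase (σ c)).powerset,
        ∏ d ∈ insert c I, g d (decide (σ d ∈ insert (σ c) V)) =
          g c true * ∏ d ∈ I, g d (decide (σ d ∈ V)) := fun V _ => by
      rw [prod_insert hc, decide_eq_true (mem_insert_self _ _)]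
      congr 1
      exact prod_congr rfl fun d hd => by simp [mem_insert, hne d hd]
    rw [← insert_erase hcs, sum_powerset_insert (notMem_erase _ _), insert_erase hcs,
      sum_congr rfl without, sum_congr rfl containing, ← mul_sum, ← mul_sum,
      ih (hσ.mono (by simp)) hI, prod_insert hc, ← card_erase_add_one hcs]
    ring

lemma sum_powerset_range {M : Type*} [AddCommMonoid M] (φ : Finset ℕ → M) (L : ℕ) :
    ∑ D ∈ (range L).powerset, φ D =
      φ ∅ + ∑ T ∈ range L, ∑ D ∈ (range T).powerset, φ (insert T D) := by
  induction L with
  | zero => simp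
  | succ L ih =>
    rw [range_add_one, sum_powerset_insert notMem_range_self, ih, sum_insert notMem_range_self]
    abel

lemma sum_powerset_pow_mul_prod_ite_mem {K : Type*} [CommSemiring K] {α : Type*} [DecidableEq α]
    (s : Finset α) (a : K) (f g : α → K) :
    ∑ D ∈ s.powerset, a ^ #D * ∏ c ∈ s, (if c ∈ D then f c else g c) =
      ∏ c ∈ s, (a * f c + g c) := by
  rw [prod_add]
  refine sum_congr rfl fun D hD => ?_
  rw [prod_ite, filter_mem_eq_inter, inter_eq_right.2 (mem_powerset.1 hD),
    filter_notMem_eq_sdiff, prod_mul_distrib, prod_const, mul_assoc]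

lemma sum_pow_le_of_injOn {ι : Type*} {s : Finset ι} {f : ι → ℕ} (hf : Set.InjOn f s) {r : ℝ≥0}
    (hr : r < 1) : ∑ i ∈ s, r ^ f i ≤ (1 - r)⁻¹ := by
  classical
  rw [← NNReal.tsum_geometric hr, ← sum_image hf (f := fun n => r ^ n)]
  exact (NNReal.summable_geometric hr).sum_le_tsum _ fun _ _ => zero_le

lemma sum_pow_dist_le {r : ℝ≥0} (hr : r < 1) (s : Finset ℕ) (a : ℕ) :
    ∑ T ∈ s, r ^ Nat.dist T a ≤ 2 * (1 - r)⁻¹ := by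
  rw [← sum_filter_add_sum_filter_not s (· < a), two_mul]
  refine add_le_add (sum_pow_le_of_injOn ?_ hr) (sum_pow_le_of_injOn ?_ hr) <;>
  · intro x hx y hy h
    simp only [coe_filter, Set.mem_ofPred_eq, Nat.dist] at hx hy h
    omega

lemma sum_pow_dist_add_le {r : ℝ≥0} (hr : r < 1) (s : Finset ℕ) (a b : ℕ) :
    ∑ T ∈ s, r ^ Nat.dist a (T + b) ≤ 2 * (1 - r)⁻¹ := by
  rw [← sum_image (s := s) (g := (· + b)) (f := fun T => r ^ Nat.dist a T)
    (add_left_injective b).injOn]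
  simpa only [Nat.dist_comm] using sum_pow_dist_le hr (s.image (· + b)) a

/-! ### Hölder's inequality along a chain -/

lemma sum_rpow_mul_rpow_le {ι : Type*} (I : Finset ι) (u v : ι → ℝ≥0) {s t : ℝ} (hs : 0 < s)
    (ht : 0 < t) (hst : s + t = 1) :
    ∑ i ∈ I, u i ^ s * v i ^ t ≤ (∑ i ∈ I, u i) ^ s * (∑ i ∈ I, v i) ^ t := by
  have hpq : (s⁻¹).HolderConjugate t⁻¹ :=
    Real.holderConjugate_iff.2 ⟨one_lt_inv_iff₀.2 ⟨hs, by linarith⟩, by simpa using hst⟩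
  simpa [NNReal.rpow_rpow_inv, hs.ne', ht.ne'] using
    NNReal.inner_le_Lp_mul_Lq I (fun i => u i ^ s) (fun i => v i ^ t) hpq

lemma sum_rpow_third_le {ι : Type*} (I : Finset ι) (u v w : ι → ℝ≥0) :
    ∑ i ∈ I, (u i * v i * w i) ^ (1 / 3 : ℝ) ≤
      ((∑ i ∈ I, u i) * (∑ i ∈ I, v i) * ∑ i ∈ I, w i) ^ (1 / 3 : ℝ) := by
  have split (a b c : ℝ≥0) : (a * b * c) ^ (1 / 3 : ℝ) =
      a ^ (1 / 3 : ℝ) * (b ^ (1 / 2 : ℝ) * c ^ (1 / 2 : ℝ)) ^ (2 / 3 : ℝ) := by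
    rw [← NNReal.mul_rpow, ← NNReal.rpow_mul, mul_assoc, NNReal.mul_rpow]
    norm_num
  simp only [split]
  refine (sum_rpow_mul_rpow_le I _ _ (by norm_num) (by norm_num) (by norm_num)).trans ?_
  gcongr
  exact sum_rpow_mul_rpow_le I v w (by norm_num) (by norm_num) (by norm_num)

section Chains

variable {Ω : Type*} {k : ℕ}

lemma sum_piFinset_succ {M : Type*} [AddCommMonoid M] (S : Fin (k + 1) → Finset Ω)
    (φ : (Fin (k + 1) → Ω) → M) :
    ∑ Z ∈ Fintype.piFinset S, φ Z =
      ∑ Z ∈ Fintype.piFinset (Fin.tail S), ∑ z ∈ S 0, φ (Fin.cons z Z) := by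
  rw [← sum_product']
  refine sum_nbij' (fun Z => (Fin.tail Z, Z 0)) (fun p => Fin.cons p.2 p.1) ?_ ?_ ?_ ?_ ?_
  · intro Z hZ
    rw [Fin.mem_piFinset_iff_zero_tail] at hZ
    exact mem_product.2 hZ.symm
  · intro p hp
    simp only [Fin.mem_piFinset_iff_zero_tail, Fin.cons_zero, Fin.tail_cons]
    exact (mem_product.1 hp).symm
  · intro Z _; simp
  · intro p _; simp
  · intro Z _; simp

/-- A product over the `k` windows of three consecutive terms of a sequence of length `k + 2`. -/
def chainProd {M : Type*} [CommMonoid M] (F : Fin k → Ω → Ω → Ω → M) (Z : Fin (k + 2) → Ω) : M :=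
  ∏ e : Fin k, F e (Z e.castSucc.castSucc) (Z e.succ.castSucc) (Z e.succ.succ)

lemma chainProd_cons {M : Type*} [CommMonoid M] (F : Fin (k + 1) → Ω → Ω → Ω → M) (z : Ω)
    (Z : Fin (k + 2) → Ω) :
    chainProd F (Fin.cons z Z) = F 0 z (Z 0) (Z 1) * chainProd (fun e => F e.succ) Z := by
  rw [chainProd, Fin.prod_univ_succ]
  rfl

lemma sum_cons_chainProd_rpow_third_le (S : Finset Ω) (a : Ω → ℝ≥0) (b : Ω → Ω → ℝ≥0)
    (f : Fin (k + 1) → Ω → Ω → Ω → ℝ≥0) (Z : Fin (k + 2) → Ω) :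
    ∑ z ∈ S, (a z * b z (Z 0) * chainProd f (Fin.cons z Z)) ^ (1 / 3 : ℝ) ≤
      (∑ z ∈ S, a z) ^ (1 / 3 : ℝ) * ((∑ z ∈ S, b z (Z 0)) *
        (∑ z ∈ S, f 0 z (Z 0) (Z 1)) * chainProd (fun e => f e.succ) Z) ^ (1 / 3 : ℝ) := by
  have split (z : Ω) : (a z * b z (Z 0) * chainProd f (Fin.cons z Z)) ^ (1 / 3 : ℝ) =
      (a z * b z (Z 0) * f 0 z (Z 0) (Z 1)) ^ (1 / 3 : ℝ) *
        chainProd (fun e => f e.succ) Z ^ (1 / 3 : ℝ) := by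
    rw [chainProd_cons, ← mul_assoc, NNReal.mul_rpow]
  simp only [split]
  rw [← sum_mul, ← NNReal.mul_rpow, ← mul_assoc, ← mul_assoc, NNReal.mul_rpow]
  gcongr
  exact sum_rpow_third_le _ _ _ _

/-- Each term of a sequence lies in at most three windows, so that exponents `1 / 3` suffice. The
weights `a` and `b` take the place of the windows that would begin before the sequence, which is
what makes the induction on the length work. -/
lemma sum_weighted_chainProd_rpow_third_le (S : Fin (k + 2) → Finset Ω) (a : Ω → ℝ≥0)
    (b : Ω → Ω → ℝ≥0) (f : Fin k → Ω → Ω → Ω → ℝ≥0) :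
    ∑ Z ∈ Fintype.piFinset S, (a (Z 0) * b (Z 0) (Z 1) * chainProd f Z) ^ (1 / 3 : ℝ) ≤
      ((∑ x ∈ S 0, a x) * (∑ x ∈ S 0, ∑ y ∈ S 1, b x y) *
        (∏ e, ∑ x ∈ S e.castSucc.castSucc, ∑ y ∈ S e.succ.castSucc, ∑ z ∈ S e.succ.succ, f e x y z)
          * (#(S (Fin.last k).castSucc) * #(S (Fin.last (k + 1))) ^ 2)) ^ (1 / 3 : ℝ) := by
  induction k generalizing a b with
  | zero =>
    simp only [chainProd, univ_eq_empty, prod_empty, mul_one]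
    have reindex : ∑ Z ∈ Fintype.piFinset S, (a (Z 0) * b (Z 0) (Z 1)) ^ (1 / 3 : ℝ) =
        ∑ p ∈ S 0 ×ˢ S 1, (a p.1 * b p.1 p.2 * 1) ^ (1 / 3 : ℝ) := by
      simp_rw [mul_one]
      rw [sum_piFinset_succ, sum_piFinset_succ, sum_product_right]
      simp [Fin.tail, univ_unique]
    rw [reindex]
    refine (sum_rpow_third_le _ _ _ _).trans_eq ?_
    rw [sum_product, sum_product]
    simp only [sum_const, card_product, nsmul_eq_mul, mul_one, ← mul_sum]
    congr 1
    push_cast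
    ring
  | succ k ih =>
    rw [sum_piFinset_succ]
    refine (sum_le_sum fun Z _ => sum_cons_chainProd_rpow_third_le (S 0) a b f Z).trans ?_
    rw [← mul_sum]
    refine (mul_le_mul_right (ih (Fin.tail S) (fun y => ∑ z ∈ S 0, b z y)
      (fun y y' => ∑ z ∈ S 0, f 0 z y y') (fun e => f e.succ)) _).trans_eq ?_
    rw [← NNReal.mul_rpow, Fin.prod_univ_succ]
    have swap_b : ∑ y ∈ S 1, ∑ x ∈ S 0, b x y = ∑ x ∈ S 0, ∑ y ∈ S 1, b x y := sum_comm
    have swap_f : ∑ y ∈ S 1, ∑ z ∈ S 2, ∑ x ∈ S 0, f 0 x y z =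
        ∑ x ∈ S 0, ∑ y ∈ S 1, ∑ z ∈ S 2, f 0 x y z := by
      rw [sum_comm (s := S 0)]
      exact sum_congr rfl fun y _ => sum_comm
    congr 1
    change (∑ z ∈ S 0, a z) * ((∑ y ∈ S 1, ∑ x ∈ S 0, b x y) *
      (∑ y ∈ S 1, ∑ z ∈ S 2, ∑ x ∈ S 0, f 0 x y z) * _ * _) =
      (∑ z ∈ S 0, a z) * (∑ x ∈ S 0, ∑ y ∈ S 1, b x y) *
        ((∑ x ∈ S 0, ∑ y ∈ S 1, ∑ z ∈ S 2, f 0 x y z) * _) * _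
    rw [swap_b, swap_f]
    simp only [mul_assoc]
    rfl

lemma sum_chainProd_rpow_third_le (S : Fin (k + 2) → Finset Ω) (f : Fin k → Ω → Ω → Ω → ℝ≥0)
    {N : ℕ} (hS : ∀ j, #(S j) ≤ N) :
    ∑ Z ∈ Fintype.piFinset S, chainProd f Z ^ (1 / 3 : ℝ) ≤
      N ^ 2 * ∏ e, (∑ x ∈ S e.castSucc.castSucc, ∑ y ∈ S e.succ.castSucc,
        ∑ z ∈ S e.succ.succ, f e x y z) ^ (1 / 3 : ℝ) := by
  have h := sum_weighted_chainProd_rpow_third_le S (fun _ => 1) (fun _ _ => 1) f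
  simp only [one_mul, sum_const, nsmul_eq_mul, mul_one] at h
  refine h.trans ?_
  rw [NNReal.finsetProd_rpow]
  generalize ∏ e, ∑ x ∈ S e.castSucc.castSucc, ∑ y ∈ S e.succ.castSucc, ∑ z ∈ S e.succ.succ,
    f e x y z = P
  calc _ ≤ (N * (N * N) * P * (N * N ^ 2) : ℝ≥0) ^ (1 / 3 : ℝ) := by
        gcongr <;> exact hS _
    _ = ((N ^ 2) ^ 3 * P : ℝ≥0) ^ (1 / 3 : ℝ) := by ring_nf
    _ = N ^ 2 * P ^ (1 / 3 : ℝ) := by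
      rw [NNReal.mul_rpow, one_div]
      exact congrArg (· * _) (NNReal.pow_rpow_inv_natCast _ three_ne_zero)

lemma sum_chainProd_le_of_sum_le (S : Finset Ω) (H : Ω → Ω → Ω → ℝ≥0) {K : ℝ≥0}
    (hH : ∀ y z, ∑ x ∈ S, H x y z ≤ K) :
    ∑ m ∈ Fintype.piFinset (fun _ : Fin (k + 2) => S), chainProd (fun _ => H) m ≤
      #S ^ 2 * K ^ k := by
  induction k with
  | zero => simp [chainProd, Fintype.card_piFinset]
  | succ k ih =>
    rw [sum_piFinset_succ]
    calc _ ≤ ∑ m ∈ Fintype.piFinset (fun _ : Fin (k + 2) => S), K * chainProd (fun _ => H) m := by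
          refine sum_le_sum fun m _ => ?_
          simp only [chainProd_cons, ← sum_mul]
          gcongr
          exact hH _ _
      _ ≤ K * (#S ^ 2 * K ^ k) := by rw [← mul_sum]; gcongr
      _ = #S ^ 2 * K ^ (k + 1) := by ring

end Chains

/-! ### Pairs of sets whose sumset avoids a given set -/

/-- The sets `insert L X` with `X ⊆ {0, …, L - 1}`. They encode the subsets of `{0, …, L - 1}` by
sets that all have a minimum, which is at most `L`. -/
def cappedSets (L : ℕ) : Finset (Finset ℕ) := (range L).powerset.image (insert L)

/-- The members of `cappedSets L` with minimum `α`. -/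
noncomputable def cappedSetsWithMin (L α : ℕ) : Finset (Finset ℕ) :=
  {X ∈ cappedSets L | sInf (X : Set ℕ) = α}

lemma card_cappedSets_le (L : ℕ) : #(cappedSets L) ≤ 2 ^ L :=
  card_image_le.trans_eq (by rw [card_powerset, card_range])

lemma sInf_le_of_mem_cappedSets {L : ℕ} {X : Finset ℕ} (hX : X ∈ cappedSets L) :
    sInf (X : Set ℕ) ≤ L := by
  obtain ⟨Y, -, rfl⟩ := mem_image.1 hX
  exact Nat.sInf_le (mem_insert_self L Y)

lemma exists_insert_eq_of_mem_cappedSetsWithMin {L α : ℕ} {X : Finset ℕ}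
    (hX : X ∈ cappedSetsWithMin L α) : ∃ V ∈ (Ioc α L).powerset, insert α V = X := by
  obtain ⟨hXL, rfl⟩ := mem_filter.1 hX
  obtain ⟨Y, hY, rfl⟩ := mem_image.1 hXL
  have hmem : sInf ((insert L Y : Finset ℕ) : Set ℕ) ∈ insert L Y :=
    mem_coe.1 (Nat.sInf_mem ⟨L, mem_insert_self L Y⟩)
  refine ⟨(insert L Y).erase _, ?_, insert_erase hmem⟩
  refine mem_powerset.2 fun a ha => ?_
  obtain ⟨hne, ha⟩ := mem_erase.1 ha
  refine mem_Ioc.2 ⟨lt_of_le_of_ne (Nat.sInf_le ha) hne.symm, ?_⟩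
  rcases mem_insert.1 ha with rfl | ha
  · exact le_rfl
  · exact (mem_range.1 (mem_powerset.1 hY ha)).le

lemma sum_cappedSetsWithMin_le (L α : ℕ) (φ : Finset ℕ → ℝ≥0) :
    ∑ X ∈ cappedSetsWithMin L α, φ X ≤ ∑ V ∈ (Ioc α L).powerset, φ (insert α V) := by
  have hinj : Set.InjOn (insert α) ((Ioc α L).powerset : Set (Finset ℕ)) :=
    fun V hV W hW h => by
      have notMem {U : Finset ℕ} (hU : U ∈ ((Ioc α L).powerset : Set (Finset ℕ))) : α ∉ U :=
        fun h => by simpa using mem_powerset.1 hU h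
      rw [← erase_insert (notMem hV), h, erase_insert (notMem hW)]
  rw [← sum_image hinj]
  exact sum_le_sum_of_subset fun X hX => by
    obtain ⟨V, hV, rfl⟩ := exists_insert_eq_of_mem_cappedSetsWithMin hX
    exact mem_image_of_mem _ hV

/-- The pairs of members of `cappedSets L` with minima `m.1` and `m.2`. -/
noncomputable def cappedPairsWithMin (L : ℕ) (m : ℕ × ℕ) : Finset (Finset ℕ × Finset ℕ) :=
  cappedSetsWithMin L m.1 ×ˢ cappedSetsWithMin L m.2

/-- The pairs in `cappedPairsWithMin L m` whose sumset misses `D`. -/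
noncomputable def avoidingPairs (L : ℕ) (m : ℕ × ℕ) (D : Finset ℕ) : Finset (Finset ℕ × Finset ℕ) :=
  {Z ∈ cappedPairsWithMin L m | Disjoint (Z.1 + Z.2) D}

lemma le_of_mem_cappedPairsWithMin {L : ℕ} {m : ℕ × ℕ} {Z : Finset ℕ × Finset ℕ}
    (hZ : Z ∈ cappedPairsWithMin L m) : m.1 ≤ L ∧ m.2 ≤ L := by
  simp only [cappedPairsWithMin, cappedSetsWithMin, mem_product, mem_filter] at hZ
  obtain ⟨⟨h₁, h₁'⟩, h₂, h₂'⟩ := hZ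
  exact ⟨h₁' ▸ sInf_le_of_mem_cappedSets h₁, h₂' ▸ sInf_le_of_mem_cappedSets h₂⟩

lemma two_pow_sub_mul_two_pow_sub {a b L : ℕ} (ha : a ≤ L) (hb : b ≤ L) :
    (2 : ℝ≥0) ^ (L - a) * 2 ^ (L - b) = 4 ^ L * (1 / 2) ^ (a + b) := by
  rw [pow_sub₀ _ two_ne_zero ha, pow_sub₀ _ two_ne_zero hb, show (4 : ℝ≥0) = 2 * 2 by norm_num,
    mul_pow, pow_add, one_div, inv_pow, inv_pow]
  ring

lemma card_avoidingPairs_le_sum (L : ℕ) (m : ℕ × ℕ) (D : Finset ℕ) :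
    (#(avoidingPairs L m D) : ℝ≥0) ≤
      ∑ V ∈ (Ioc m.1 L).powerset, ∑ W ∈ (Ioc m.2 L).powerset,
        if Disjoint (insert m.1 V + insert m.2 W) D then 1 else 0 := by
  rw [avoidingPairs, card_filter, cappedPairsWithMin, sum_product]
  push_cast
  exact (sum_cappedSetsWithMin_le L m.1 _).trans
    (sum_le_sum fun _ _ => sum_cappedSetsWithMin_le L m.2 _)

lemma card_avoidingPairs_le (L : ℕ) (m : ℕ × ℕ) (D : Finset ℕ) :
    (#(avoidingPairs L m D) : ℝ≥0) ≤ 4 ^ L * (1 / 2) ^ (m.1 + m.2) := by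
  rcases (avoidingPairs L m D).eq_empty_or_nonempty with h | ⟨Z, hZ⟩
  · simp [h]
  obtain ⟨h₁, h₂⟩ := le_of_mem_cappedPairsWithMin (mem_filter.1 hZ).1
  rw [← two_pow_sub_mul_two_pow_sub h₁ h₂]
  refine (card_avoidingPairs_le_sum L m D).trans ?_
  calc _ ≤ ∑ _ ∈ (Ioc m.1 L).powerset, ∑ _ ∈ (Ioc m.2 L).powerset, (1 : ℝ≥0) := by
        gcongr; split_ifs <;> simp
    _ = _ := by simp [mul_comm]

/-- `x` and `y` tell whether `c - β ∈ V` and `T + β - c ∈ W`, where `α = min V` and `β = min W`; the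
weight is `0` when one of the sums `T = (c - β) + (T + β - c)`, `c = (c - β) + β` and
`T + α + β - c = α + (T + β - c)` rules out that `V + W` misses `insert T D`. -/
def sumWeight (τ T : ℕ) (D : Finset ℕ) (c : ℕ) (x y : Bool) : ℝ≥0 :=
  if x && y || x && decide (c ∈ D) || y && decide (T + τ - c ∈ D) then 0 else 1

lemma disjoint_add_indicator_le_prod {V W D : Finset ℕ} {T α β : ℕ} :
    (if Disjoint (insert α V + insert β W) (insert T D) then (1 : ℝ≥0) else 0) ≤
      ∏ c ∈ range T with α + β < c,
        sumWeight (α + β) T D c (decide (c - β ∈ V)) (decide (T + β - c ∈ W)) := by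
  split_ifs with h
  · refine (prod_eq_one fun c hc => ?_).ge
    rw [mem_filter, mem_range] at hc
    have key {a b s : ℕ} (ha : a ∈ insert α V) (hb : b ∈ insert β W) (hs : a + b = s) :
        s ∉ insert T D := hs ▸ disjoint_left.1 h (add_mem_add ha hb)
    have hxy (hx : c - β ∈ V) (hy : T + β - c ∈ W) : False :=
      key (mem_insert_of_mem hx) (mem_insert_of_mem hy) (by omega) (mem_insert_self T D)
    have hx (hx : c - β ∈ V) (hD : c ∈ D) : False :=
      key (mem_insert_of_mem hx) (mem_insert_self β W) (by omega) (mem_insert_of_mem hD)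
    have hy (hy : T + β - c ∈ W) (hD : T + (α + β) - c ∈ D) : False :=
      key (mem_insert_self α V) (mem_insert_of_mem hy) (by omega) (mem_insert_of_mem hD)
    refine if_neg ?_
    simp only [Bool.or_eq_true, Bool.and_eq_true, decide_eq_true_eq]
    tauto
  · exact zero_le

/-- The average of `sumWeight τ T D c` over its two Boolean arguments. -/
noncomputable def averageWeight (τ T : ℕ) (D : Finset ℕ) (c : ℕ) : ℝ≥0 :=
  ((sumWeight τ T D c true true + sumWeight τ T D c true false) / 2 +
    (sumWeight τ T D c false true + sumWeight τ T D c false false) / 2) / 2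

/-- If neither of the reflected indices `c` and `T + τ - c` lies in `D`, three of the four values of
`(x, y)` have weight `1`; if one of them does, two; if both do, one. This is where `3 / 4` and
`1 / 3` come from. -/
lemma sq_averageWeight_le (τ T : ℕ) (D : Finset ℕ) (c : ℕ) :
    averageWeight τ T D c ^ 2 ≤
      (if c ∈ D then 1 / 3 else 3 / 4) * if T + τ - c ∈ D then 1 / 3 else 3 / 4 := by
  by_cases h : c ∈ D <;> by_cases h' : T + τ - c ∈ D <;>
  · simp only [averageWeight, sumWeight, h, h', decide_true, decide_false, Bool.and_true,
      Bool.and_false, Bool.or_true, Bool.or_false, if_true, Bool.false_eq_true, if_false]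
    rw [← NNReal.coe_le_coe]
    push_cast
    norm_num

lemma prod_reflect_filter_lt {M : Type*} [CommMonoid M] (T τ : ℕ) (f : ℕ → M) :
    ∏ c ∈ range T with τ < c, f (T + τ - c) = ∏ c ∈ range T with τ < c, f c := by
  refine prod_nbij' (T + τ - ·) (T + τ - ·) ?_ ?_ ?_ ?_ fun _ _ => rfl <;>
  · intro c hc
    simp only [mem_filter, mem_range] at hc ⊢
    omega

lemma prod_averageWeight_le (τ T : ℕ) (D : Finset ℕ) :
    ∏ c ∈ range T with τ < c, averageWeight τ T D c ≤
      ∏ c ∈ range T with τ < c, if c ∈ D then 1 / 3 else 3 / 4 := by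
  suffices hsq : (∏ c ∈ range T with τ < c, averageWeight τ T D c) ^ 2 ≤
      (∏ c ∈ range T with τ < c, if c ∈ D then 1 / 3 else 3 / 4) ^ 2 from
    (pow_le_pow_iff_left₀ zero_le zero_le two_ne_zero).1 hsq
  rw [← prod_pow]
  refine (prod_le_prod' fun c _ => sq_averageWeight_le τ T D c).trans_eq ?_
  rw [prod_mul_distrib, sq,
    prod_reflect_filter_lt T τ fun c => if c ∈ D then (1 / 3 : ℝ≥0) else 3 / 4]

lemma sum_powerset_prod_sumWeight {L T : ℕ} (hT : T ≤ L) (α β : ℕ) (D : Finset ℕ) :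
    ∑ V ∈ (Ioc α L).powerset, ∑ W ∈ (Ioc β L).powerset, ∏ c ∈ range T with α + β < c,
        sumWeight (α + β) T D c (decide (c - β ∈ V)) (decide (T + β - c ∈ W)) =
      2 ^ (L - α) * 2 ^ (L - β) * ∏ c ∈ range T with α + β < c, averageWeight (α + β) T D c := by
  set I := {c ∈ range T | α + β < c}
  have hI {c : ℕ} (hc : c ∈ I) : c < T ∧ α + β < c := by simpa [I] using hc
  have hinjV : Set.InjOn (· - β) (I : Set ℕ) := fun c hc d hd h => by
    have := hI hc; have := hI hd; dsimp only at h; omega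
  have hinjW : Set.InjOn (T + β - ·) (I : Set ℕ) := fun c hc d hd h => by
    have := hI hc; have := hI hd; dsimp only at h; omega
  have hmapV : ∀ c ∈ I, c - β ∈ Ioc α L := fun c hc => by
    have := hI hc; rw [mem_Ioc]; omega
  have hmapW : ∀ c ∈ I, T + β - c ∈ Ioc β L := fun c hc => by
    have := hI hc; rw [mem_Ioc]; omega
  simp_rw [sum_powerset_prod_decide_mem hinjW hmapW fun c => sumWeight (α + β) T D c _]
  rw [← mul_sum, sum_powerset_prod_decide_mem hinjV hmapV fun c x =>
    (sumWeight (α + β) T D c x true + sumWeight (α + β) T D c x false) / 2,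
    Nat.card_Ioc, Nat.card_Ioc, ← mul_assoc, mul_comm (2 ^ (L - β))]
  rfl

lemma card_avoidingPairs_insert_le {L T : ℕ} (hT : T ≤ L) (m : ℕ × ℕ) (D : Finset ℕ) :
    (#(avoidingPairs L m (insert T D)) : ℝ≥0) ≤ 4 ^ L * (1 / 2) ^ (m.1 + m.2) *
      ∏ c ∈ range T with m.1 + m.2 < c, if c ∈ D then 1 / 3 else 3 / 4 := by
  rcases (avoidingPairs L m (insert T D)).eq_empty_or_nonempty with h | ⟨Z, hZ⟩
  · simp [h]
  obtain ⟨hα, hβ⟩ := le_of_mem_cappedPairsWithMin (mem_filter.1 hZ).1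
  calc (#(avoidingPairs L m (insert T D)) : ℝ≥0)
      ≤ ∑ V ∈ (Ioc m.1 L).powerset, ∑ W ∈ (Ioc m.2 L).powerset,
          ∏ c ∈ range T with m.1 + m.2 < c,
            sumWeight (m.1 + m.2) T D c (decide (c - m.2 ∈ V)) (decide (T + m.2 - c ∈ W)) :=
        (card_avoidingPairs_le_sum L _ _).trans <|
          sum_le_sum fun _ _ => sum_le_sum fun _ _ => disjoint_add_indicator_le_prod
    _ = 4 ^ L * (1 / 2) ^ (m.1 + m.2) *
          ∏ c ∈ range T with m.1 + m.2 < c, averageWeight (m.1 + m.2) T D c := by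
        rw [sum_powerset_prod_sumWeight hT, two_pow_sub_mul_two_pow_sub hα hβ]
    _ ≤ _ := mul_le_mul_right (prod_averageWeight_le _ T D) _

/-! ### Three consecutive pairs of columns -/

/-- The positions below `L` left free by three consecutive pairs `x`, `y` and `z` of columns. If the
`j`-th pair sits over the abscissas `x₀ + j` and `y₀ + j`, then all three of these sumsets lie over
one abscissa, and a sum-free set misses them. -/
def chainFree (L : ℕ) (x y z : Finset ℕ × Finset ℕ) : Finset ℕ :=
  range L \ ((y.1 + y.2) ∪ (z.1 + x.2) ∪ (x.1 + z.2))

lemma eight_pow_card_chainFree (L : ℕ) (x y z : Finset ℕ × Finset ℕ) :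
    (8 : ℝ≥0) ^ #(chainFree L x y z) = ∑ D ∈ (range L).powerset, 7 ^ #D *
      ((if Disjoint (y.1 + y.2) D then 1 else 0) * ((if Disjoint (z.1 + x.2) D then 1 else 0) *
        if Disjoint (x.1 + z.2) D then 1 else 0)) := by
  have hfilter : (chainFree L x y z).powerset = {D ∈ (range L).powerset |
      Disjoint (y.1 + y.2) D ∧ Disjoint (z.1 + x.2) D ∧ Disjoint (x.1 + z.2) D} := by
    ext D
    simp only [chainFree, mem_powerset, mem_filter, subset_sdiff, disjoint_comm (b := D),
      disjoint_union_right, and_assoc]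
  have hbinom := sum_pow_mul_eq_add_pow (7 : ℝ≥0) 1 (chainFree L x y z)
  simp only [one_pow, mul_one] at hbinom
  rw [show (8 : ℝ≥0) = 7 + 1 by norm_num, ← hbinom, hfilter, sum_filter]
  simp only [mul_ite, mul_one, mul_zero, ← ite_and, and_comm]

lemma sum_sum_sum_sum_comm {α β γ δ M : Type*} [AddCommMonoid M] (s : Finset α) (t : Finset β)
    (u : Finset γ) (v : Finset δ) (f : α → β → γ → δ → M) :
    ∑ x ∈ s, ∑ y ∈ t, ∑ z ∈ u, ∑ d ∈ v, f x y z d =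
      ∑ d ∈ v, ∑ y ∈ t, ∑ x ∈ s, ∑ z ∈ u, f x y z d :=
  calc _ = ∑ x ∈ s, ∑ d ∈ v, ∑ y ∈ t, ∑ z ∈ u, f x y z d :=
        sum_congr rfl fun _ _ => (sum_congr rfl fun _ _ => sum_comm).trans sum_comm
    _ = _ := sum_comm.trans (sum_congr rfl fun _ _ => sum_comm)

lemma sum_product_mul_sum_product {α β R : Type*} [CommSemiring R] (A C : Finset α)
    (B E : Finset β) (f g : α → β → R) :
    ∑ x ∈ A ×ˢ B, ∑ z ∈ C ×ˢ E, f z.1 x.2 * g x.1 z.2 =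
      (∑ p ∈ C ×ˢ B, f p.1 p.2) * ∑ p ∈ A ×ˢ E, g p.1 p.2 := by
  rw [sum_mul_sum, ← sum_product', ← sum_product']
  refine sum_nbij' (fun q => ((q.2.1, q.1.2), (q.1.1, q.2.2)))
    (fun q => ((q.2.1, q.1.2), (q.1.1, q.2.2))) ?_ ?_ (fun _ _ => rfl) (fun _ _ => rfl)
    fun _ _ => rfl <;>
  · simp only [mem_product]; tauto

/-- The minima of the three sumsets in `chainFree L x y z`, each split as the sum of the minima of
its two summands, when `x`, `y` and `z` have minima `m`, `m'` and `m''`. -/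
def windowMinima (m m' m'' : ℕ × ℕ) : Fin 3 → ℕ × ℕ := ![m', (m''.1, m.2), (m.1, m''.2)]

lemma sum_eight_pow_card_chainFree (L : ℕ) (m m' m'' : ℕ × ℕ) :
    ∑ x ∈ cappedPairsWithMin L m, ∑ y ∈ cappedPairsWithMin L m',
        ∑ z ∈ cappedPairsWithMin L m'', (8 : ℝ≥0) ^ #(chainFree L x y z) =
      ∑ D ∈ (range L).powerset, (7 : ℝ≥0) ^ #D *
        ∏ i, (#(avoidingPairs L (windowMinima m m' m'' i) D) : ℝ≥0) := by
  have card_eq (p : ℕ × ℕ) (D : Finset ℕ) : (#(avoidingPairs L p D) : ℝ≥0) =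
      ∑ Z ∈ cappedPairsWithMin L p, if Disjoint (Z.1 + Z.2) D then 1 else 0 := by
    rw [avoidingPairs, card_filter]
    push_cast
    rfl
  simp_rw [eight_pow_card_chainFree, Fin.prod_univ_three, card_eq, mul_assoc]
  rw [sum_sum_sum_sum_comm]
  refine sum_congr rfl fun D _ => ?_
  simp_rw [← mul_sum]
  rw [sum_mul]
  congr 1
  refine sum_congr rfl fun y _ => ?_
  congr 1
  simp only [cappedPairsWithMin, windowMinima, Matrix.cons_val]
  exact sum_product_mul_sum_product _ _ _ _
    (fun V W => if Disjoint (V + W) D then (1 : ℝ≥0) else 0)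
    fun V W => if Disjoint (V + W) D then 1 else 0

lemma prod_sum_weights_le (τ : Fin 3 → ℕ) (c : ℕ) :
    7 * (∏ i, if τ i < c then (1 / 3 : ℝ≥0) else 1) + ∏ i, (if τ i < c then 3 / 4 else 1) ≤
      ∏ i, if τ i < c then 9 / 10 else 2 := by
  simp only [Fin.prod_univ_three]
  rw [← NNReal.coe_le_coe]
  push_cast
  split_ifs <;> norm_num

lemma half_pow_mul_prod_le (τ T : ℕ) :
    (1 / 2 : ℝ≥0) ^ τ * ∏ c ∈ range T, (if τ < c then 9 / 10 else 2) ≤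
      3 * (9 / 10) ^ Nat.dist T τ := by
  have half_le : (1 / 2 : ℝ≥0) ≤ 9 / 10 := by
    rw [← NNReal.coe_le_coe]; push_cast; norm_num
  have two_le : (2 : ℝ≥0) ≤ 3 * (9 / 10) := by
    rw [← NNReal.coe_le_coe]; push_cast; norm_num
  rcases le_or_gt T τ with h | h
  · obtain ⟨j, rfl⟩ := Nat.exists_eq_add_of_le h
    have hprod : ∏ c ∈ range T, (if T + j < c then (9 / 10 : ℝ≥0) else 2) = 2 ^ T :=
      (prod_congr rfl fun c hc => if_neg (by have := mem_range.1 hc; omega)).trans (by simp)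
    rw [hprod, Nat.dist_eq_sub_of_le h, Nat.add_sub_cancel_left, pow_add, mul_right_comm,
      ← mul_pow, one_div_mul_cancel two_ne_zero, one_pow]
    exact mul_le_mul' (by norm_num) (pow_le_pow_left₀ zero_le half_le j)
  · obtain ⟨j, rfl⟩ := Nat.exists_eq_add_of_le (Nat.succ_le_of_lt h)
    have hlow : ∏ c ∈ range (τ + 1), (if τ < c then (9 / 10 : ℝ≥0) else 2) = 2 ^ (τ + 1) :=
      (prod_congr rfl fun c hc => if_neg (by have := mem_range.1 hc; omega)).trans (by simp)
    have hhigh : ∏ i ∈ range j, (if τ < τ + 1 + i then (9 / 10 : ℝ≥0) else 2) = (9 / 10) ^ j :=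
      (prod_congr rfl fun _ _ => if_pos (by omega)).trans (by simp [div_pow])
    rw [Nat.succ_eq_add_one, prod_range_add, hlow, hhigh, Nat.dist_comm,
      Nat.dist_eq_sub_of_le (by omega), show τ + 1 + j - τ = j + 1 by omega, pow_succ, pow_succ',
      ← mul_assoc, ← mul_assoc, ← mul_assoc, ← mul_pow, one_div_mul_cancel two_ne_zero, one_pow,
      one_mul]
    exact mul_le_mul_left two_le _

lemma prod_ite_mem_prod_ite {ι α M : Type*} [Fintype ι] [DecidableEq α] [CommMonoid M]
    (s D : Finset α) (p : ι → α → Prop) [∀ i c, Decidable (p i c)] (a b : M) :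
    (∏ c ∈ s, if c ∈ D then ∏ i, (if p i c then a else 1) else ∏ i, if p i c then b else 1) =
      ∏ i, ∏ c ∈ s with p i c, if c ∈ D then a else b := by
  simp only [prod_filter]
  rw [prod_comm]
  refine prod_congr rfl fun c _ => ?_
  by_cases h : c ∈ D <;> simp only [h, if_true, if_false]

lemma sum_pow_mul_prod_card_avoidingPairs_insert_le {L T : ℕ} (hT : T ≤ L) (m : Fin 3 → ℕ × ℕ) :
    ∑ D ∈ (range T).powerset, (7 : ℝ≥0) ^ #(insert T D) *
        ∏ i, (#(avoidingPairs L (m i) (insert T D)) : ℝ≥0) ≤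
      7 * ∏ i, 3 * 4 ^ L * (9 / 10) ^ Nat.dist T ((m i).1 + (m i).2) := by
  set τ : Fin 3 → ℕ := fun i => (m i).1 + (m i).2
  have hterm (D) (hD : D ∈ (range T).powerset) :
      (7 : ℝ≥0) ^ #(insert T D) * ∏ i, (#(avoidingPairs L (m i) (insert T D)) : ℝ≥0) ≤
      7 * (∏ i, 4 ^ L * (1 / 2) ^ τ i) * (7 ^ #D * ∏ c ∈ range T,
        if c ∈ D then ∏ i, (if τ i < c then 1 / 3 else 1)
        else ∏ i, if τ i < c then 3 / 4 else 1) := by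
    have hTD : T ∉ D := fun h => by simpa using mem_powerset.1 hD h
    rw [prod_ite_mem_prod_ite]
    calc _ ≤ 7 ^ #(insert T D) * ∏ i, (4 ^ L * (1 / 2) ^ τ i *
            ∏ c ∈ range T with τ i < c, if c ∈ D then (1 / 3 : ℝ≥0) else 3 / 4) := by
          gcongr with i
          exact card_avoidingPairs_insert_le hT _ D
      _ = _ := by rw [card_insert_of_notMem hTD, prod_mul_distrib]; ring
  calc ∑ D ∈ (range T).powerset, (7 : ℝ≥0) ^ #(insert T D) *
        ∏ i, (#(avoidingPairs L (m i) (insert T D)) : ℝ≥0)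
      ≤ 7 * (∏ i, 4 ^ L * (1 / 2) ^ τ i) * ∏ c ∈ range T,
          (7 * (∏ i, if τ i < c then 1 / 3 else 1) + ∏ i, if τ i < c then 3 / 4 else 1) := by
        rw [← sum_powerset_pow_mul_prod_ite_mem, mul_sum]
        exact sum_le_sum hterm
    _ ≤ 7 * (∏ i, 4 ^ L * (1 / 2) ^ τ i) *
          ∏ c ∈ range T, ∏ i, if τ i < c then 9 / 10 else 2 := by
        gcongr with c
        exact prod_sum_weights_le τ c
    _ = 7 * ∏ i, 4 ^ L * ((1 / 2) ^ τ i * ∏ c ∈ range T, if τ i < c then 9 / 10 else 2) := by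
        rw [prod_comm, mul_assoc, ← prod_mul_distrib]
        simp only [mul_assoc]
    _ ≤ 7 * ∏ i, 4 ^ L * (3 * (9 / 10) ^ Nat.dist T (τ i)) := by
        refine mul_le_mul_right (prod_le_prod' fun i _ => ?_) _
        exact mul_le_mul_right (half_pow_mul_prod_le (τ i) T) _
    _ = _ := by simp only [mul_left_comm, mul_assoc, τ]

lemma card_avoidingPairs_empty_le (L : ℕ) (m : ℕ × ℕ) :
    (#(avoidingPairs L m ∅) : ℝ≥0) ≤ 3 * 4 ^ L * (9 / 10) ^ Nat.dist 0 (m.1 + m.2) :=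
  calc _ ≤ (4 : ℝ≥0) ^ L * (1 / 2) ^ (m.1 + m.2) := card_avoidingPairs_le L m ∅
    _ ≤ 4 ^ L * (3 * (9 / 10) ^ Nat.dist 0 (m.1 + m.2)) := by
        gcongr
        simpa using half_pow_mul_prod_le (m.1 + m.2) 0
    _ = _ := by ring

lemma sum_eight_pow_card_chainFree_le_sum (L : ℕ) (m m' m'' : ℕ × ℕ) :
    ∑ x ∈ cappedPairsWithMin L m, ∑ y ∈ cappedPairsWithMin L m',
        ∑ z ∈ cappedPairsWithMin L m'', (8 : ℝ≥0) ^ #(chainFree L x y z) ≤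
      (6 * 4 ^ L) ^ 3 * ∑ T ∈ range (L + 1), ∏ i,
        (9 / 10) ^ Nat.dist T ((windowMinima m m' m'' i).1 + (windowMinima m m' m'' i).2) := by
  set p := windowMinima m m' m''
  set B : ℕ → ℝ≥0 := fun T => ∏ i, 3 * 4 ^ L * (9 / 10) ^ Nat.dist T ((p i).1 + (p i).2)
  rw [sum_eight_pow_card_chainFree, sum_powerset_range]
  calc _ ≤ B 0 + ∑ T ∈ range L, 7 * B T := by
        rw [card_empty, pow_zero, one_mul]
        gcongr with T hT
        · exact prod_le_prod' fun i _ => card_avoidingPairs_empty_le L _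
        · exact sum_pow_mul_prod_card_avoidingPairs_insert_le (mem_range.1 hT).le p
    _ ≤ ∑ T ∈ range (L + 1), B T + 7 * ∑ T ∈ range (L + 1), B T := by
        rw [← mul_sum]
        gcongr
        · exact single_le_sum (f := B) (fun _ _ => zero_le) (mem_range.2 L.succ_pos)
        · exact L.le_succ
    _ = _ := by
        have hB (T) : B T = (3 * 4 ^ L) ^ 3 *
            ∏ i, (9 / 10) ^ Nat.dist T ((p i).1 + (p i).2) := by
          simp only [B, prod_mul_distrib (f := fun _ => (3 * 4 ^ L : ℝ≥0)), prod_const, card_univ,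
            Fintype.card_fin]
        simp_rw [hB, ← mul_sum]
        ring

/-- How far the sums of minima over the abscissa shared by three consecutive pairs are from being
all equal. -/
def deviation (m m' m'' : ℕ × ℕ) : ℕ :=
  Nat.dist (m'.1 + m'.2) (m''.1 + m.2) + Nat.dist (m'.1 + m'.2) (m.1 + m''.2)

lemma prod_pow_dist_windowMinima_le (m m' m'' : ℕ × ℕ) (T : ℕ) :
    ∏ i, (9 / 10 : ℝ≥0) ^
        Nat.dist T ((windowMinima m m' m'' i).1 + (windowMinima m m' m'' i).2) ≤
      (99 / 100) ^ (3 * deviation m m' m'') * (99 / 100) ^ Nat.dist T (m'.1 + m'.2) := by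
  have hbase : (9 / 10 : ℝ≥0) ≤ (99 / 100) ^ 9 := by
    rw [← NNReal.coe_le_coe]; push_cast; norm_num
  have hone : (99 / 100 : ℝ≥0) ≤ 1 := by
    rw [← NNReal.coe_le_coe]; push_cast; norm_num
  rw [prod_pow_eq_pow_sum, ← pow_add]
  refine (pow_le_pow_left₀ zero_le hbase _).trans ?_
  rw [← pow_mul]
  refine pow_le_pow_of_le_one zero_le hone ?_
  simp only [Fin.sum_univ_three, windowMinima, Matrix.cons_val, deviation, Nat.dist]
  omega

lemma sum_eight_pow_card_chainFree_le (L : ℕ) (m m' m'' : ℕ × ℕ) :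
    ∑ x ∈ cappedPairsWithMin L m, ∑ y ∈ cappedPairsWithMin L m',
        ∑ z ∈ cappedPairsWithMin L m'', (8 : ℝ≥0) ^ #(chainFree L x y z) ≤
      (36 * 4 ^ L * (99 / 100) ^ deviation m m' m'') ^ 3 := by
  have hlt : (99 / 100 : ℝ≥0) < 1 := by
    rw [← NNReal.coe_lt_coe]; push_cast; norm_num
  have hconst : 2 * (1 - 99 / 100 : ℝ≥0)⁻¹ ≤ 6 ^ 3 := by
    rw [← NNReal.coe_le_coe]; push_cast [NNReal.coe_sub hlt.le]; norm_num
  refine (sum_eight_pow_card_chainFree_le_sum L m m' m'').trans ?_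
  calc _ ≤ (6 * 4 ^ L : ℝ≥0) ^ 3 * ∑ T ∈ range (L + 1), ((99 / 100) ^ (3 * deviation m m' m'') *
          (99 / 100) ^ Nat.dist T (m'.1 + m'.2)) := by
        gcongr with T
        exact prod_pow_dist_windowMinima_le m m' m'' T
    _ ≤ (6 * 4 ^ L) ^ 3 * ((99 / 100) ^ (3 * deviation m m' m'') * 6 ^ 3) := by
        rw [← mul_sum]
        gcongr
        exact (sum_pow_dist_le hlt _ _).trans hconst
    _ = _ := by ring

lemma sum_pow_deviation_le (s s' : Finset ℕ) (y z : ℕ × ℕ) :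
    ∑ x ∈ s ×ˢ s', (99 / 100 : ℝ≥0) ^ deviation x y z ≤ 40000 := by
  have hlt : (99 / 100 : ℝ≥0) < 1 := by
    rw [← NNReal.coe_lt_coe]; push_cast; norm_num
  calc _ = (∑ b ∈ s', (99 / 100 : ℝ≥0) ^ Nat.dist (y.1 + y.2) (b + z.1)) *
          ∑ a ∈ s, (99 / 100 : ℝ≥0) ^ Nat.dist (y.1 + y.2) (a + z.2) := by
        rw [sum_mul_sum, sum_comm, sum_product]
        simp only [deviation, pow_add, add_comm z.1]
    _ ≤ (2 * (1 - 99 / 100)⁻¹) * (2 * (1 - 99 / 100)⁻¹) :=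
        mul_le_mul' (sum_pow_dist_add_le hlt _ _ _) (sum_pow_dist_add_le hlt _ _ _)
    _ = 40000 := by
        rw [← NNReal.coe_inj]; push_cast [NNReal.coe_sub hlt.le]; norm_num

/-! ### Counting the traces on a chain -/

/-- Encodings of a sum-free set restricted to `k + 2` consecutive pairs of columns in a strip of
height `L` and to the `k` columns of the doubled strip over the middle abscissas of the triples of
consecutive pairs. -/
def chainConfigs (L k : ℕ) :
    Finset (Σ _ : Fin (k + 2) → Finset ℕ × Finset ℕ, Fin k → Finset ℕ) :=
  (Fintype.piFinset fun _ => cappedSets L ×ˢ cappedSets L).sigma fun Z =>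
    Fintype.piFinset fun e => (chainFree L (Z e.castSucc.castSucc) (Z e.succ.castSucc)
      (Z e.succ.succ)).powerset

lemma card_chainConfigs (L k : ℕ) :
    #(chainConfigs L k) = ∑ Z ∈ Fintype.piFinset fun _ => cappedSets L ×ˢ cappedSets L,
      chainProd (fun _ : Fin k => fun x y z => 2 ^ #(chainFree L x y z)) Z := by
  simp only [chainConfigs, card_sigma, Fintype.card_piFinset, card_powerset, chainProd]

lemma sum_piFinset_const_fiberwise {ι α β M : Type*} [Fintype ι] [DecidableEq ι] [DecidableEq β]
    [AddCommMonoid M] {S : Finset α} {T : Finset β} {g : α → β} (hg : ∀ x ∈ S, g x ∈ T)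
    (φ : (ι → α) → M) :
    ∑ Z ∈ Fintype.piFinset fun _ => S, φ Z =
      ∑ m ∈ Fintype.piFinset fun _ => T, ∑ Z ∈ Fintype.piFinset fun j => {x ∈ S | g x = m j},
        φ Z := by
  classical
  rw [← sum_fiberwise_of_maps_to (g := fun Z j => g (Z j)) fun Z hZ =>
    Fintype.mem_piFinset.2 fun j => hg _ (Fintype.mem_piFinset.1 hZ j)]
  refine sum_congr rfl fun m _ => sum_congr ?_ fun _ _ => rfl
  ext Z
  simp only [mem_filter, Fintype.mem_piFinset, funext_iff, forall_and]

lemma filter_sInf_eq_cappedPairsWithMin (L : ℕ) (m : ℕ × ℕ) :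
    {x ∈ cappedSets L ×ˢ cappedSets L | (sInf (x.1 : Set ℕ), sInf (x.2 : Set ℕ)) = m} =
      cappedPairsWithMin L m := by
  ext x
  simp only [cappedPairsWithMin, cappedSetsWithMin, mem_filter, mem_product, Prod.ext_iff]
  tauto

lemma card_cappedPairsWithMin_le (L : ℕ) (m : ℕ × ℕ) : #(cappedPairsWithMin L m) ≤ 4 ^ L :=
  calc _ ≤ #(cappedSets L) * #(cappedSets L) :=
        (card_product _ _).trans_le <|
          Nat.mul_le_mul (card_le_card (filter_subset _ _)) (card_le_card (filter_subset _ _))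
    _ ≤ 2 ^ L * 2 ^ L := Nat.mul_le_mul (card_cappedSets_le L) (card_cappedSets_le L)
    _ = _ := (mul_pow 2 2 L).symm

lemma two_pow_eq_eight_pow_rpow_third (n : ℕ) : (2 : ℝ≥0) ^ n = ((8 : ℝ≥0) ^ n) ^ (1 / 3 : ℝ) := by
  rw [show (8 : ℝ≥0) = 2 ^ 3 by norm_num, ← pow_mul, mul_comm, pow_mul, one_div]
  exact (NNReal.pow_rpow_inv_natCast _ three_ne_zero).symm

lemma sum_chainProd_two_pow_card_chainFree_le (L : ℕ) {k : ℕ} (m : Fin (k + 2) → ℕ × ℕ) :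
    ∑ Z ∈ Fintype.piFinset fun j => cappedPairsWithMin L (m j),
        chainProd (fun _ : Fin k => fun x y z => (2 : ℝ≥0) ^ #(chainFree L x y z)) Z ≤
      (4 ^ L) ^ 2 * chainProd (fun _ : Fin k => fun x y z =>
        36 * 4 ^ L * (99 / 100) ^ deviation x y z) m :=
  calc _ = ∑ Z ∈ Fintype.piFinset fun j => cappedPairsWithMin L (m j),
        chainProd (fun _ : Fin k => fun x y z => (8 : ℝ≥0) ^ #(chainFree L x y z)) Z ^
          (1 / 3 : ℝ) := by
        simp only [chainProd, NNReal.finsetProd_rpow, two_pow_eq_eight_pow_rpow_third]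
    _ ≤ _ := by
        refine (sum_chainProd_rpow_third_le _ _ fun j =>
          card_cappedPairsWithMin_le L (m j)).trans ?_
        push_cast
        refine mul_le_mul_right (prod_le_prod' fun e _ => ?_) _
        rw [one_div, NNReal.rpow_inv_le_iff three_pos]
        exact_mod_cast sum_eight_pow_card_chainFree_le L _ _ _

lemma add_one_sq_le_four_pow (L : ℕ) : (L + 1) ^ 2 ≤ 4 ^ L :=
  calc _ ≤ (2 ^ L) ^ 2 := Nat.pow_le_pow_left Nat.lt_two_pow_self 2
    _ = _ := by rw [← pow_mul, mul_comm, pow_mul]; norm_num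

lemma card_chainConfigs_le (L k : ℕ) : #(chainConfigs L k) ≤ 2 ^ (2 * k * L + 8 * L + 21 * k) := by
  rw [← Nat.cast_le (α := ℝ≥0), card_chainConfigs]
  set R := range (L + 1) ×ˢ range (L + 1)
  have hminima : ∀ x ∈ cappedSets L ×ˢ cappedSets L,
      (sInf (x.1 : Set ℕ), sInf (x.2 : Set ℕ)) ∈ R := fun x hx => by
    obtain ⟨h₁, h₂⟩ := mem_product.1 hx
    exact mem_product.2 ⟨mem_range_succ_iff.2 (sInf_le_of_mem_cappedSets h₁),
      mem_range_succ_iff.2 (sInf_le_of_mem_cappedSets h₂)⟩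
  have hR : (#R : ℝ≥0) ≤ 4 ^ L := by
    rw [card_product, card_range, ← sq]
    exact_mod_cast add_one_sq_le_four_pow L
  have hdev (y z : ℕ × ℕ) : ∑ x ∈ R, 36 * 4 ^ L * (99 / 100 : ℝ≥0) ^ deviation x y z ≤
      4 ^ L * 2 ^ 21 :=
    calc _ ≤ 36 * 4 ^ L * (40000 : ℝ≥0) := by
          rw [← mul_sum]
          exact mul_le_mul_right (sum_pow_deviation_le _ _ y z) _
      _ = 4 ^ L * (36 * 40000) := by ring
      _ ≤ _ := mul_le_mul_right (by norm_num) _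
  calc _ = ∑ Z ∈ Fintype.piFinset fun _ => cappedSets L ×ˢ cappedSets L,
          chainProd (fun _ : Fin k => fun x y z => (2 : ℝ≥0) ^ #(chainFree L x y z)) Z := by
        simp only [chainProd, Nat.cast_sum, Nat.cast_prod, Nat.cast_pow, Nat.cast_ofNat]
    _ ≤ ∑ m ∈ Fintype.piFinset fun _ => R, (4 ^ L) ^ 2 * chainProd (fun _ : Fin k => fun x y z =>
          36 * 4 ^ L * (99 / 100) ^ deviation x y z) m := by
        rw [sum_piFinset_const_fiberwise hminima]
        simp_rw [filter_sInf_eq_cappedPairsWithMin]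
        exact sum_le_sum fun m _ => sum_chainProd_two_pow_card_chainFree_le L m
    _ ≤ (4 ^ L) ^ 2 * (#R ^ 2 * (4 ^ L * 2 ^ 21) ^ k) := by
        rw [← mul_sum]
        exact mul_le_mul_right (sum_chainProd_le_of_sum_le R _ hdev) _
    _ ≤ (4 ^ L) ^ 2 * ((4 ^ L) ^ 2 * (4 ^ L * 2 ^ 21) ^ k) := by gcongr
    _ = _ := by
        rw [show (4 : ℝ≥0) = 2 ^ 2 by norm_num]
        simp only [← pow_mul, ← pow_add, Nat.cast_pow, Nat.cast_ofNat]
        congr 1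
        ring

/-! ### The covering of the region by two chains -/

open Classical in
/-- The part of `S` in the column over `x`, as the set of heights `i < L` above the line
`x + y = t`. -/
noncomputable def columnSlice (S : Set (ℤ × ℤ)) (L : ℕ) (x t : ℤ) : Finset ℕ :=
  {i ∈ range L | (x, t + (i : ℤ) - x) ∈ S}

lemma mem_columnSlice {S : Set (ℤ × ℤ)} {L : ℕ} {x t : ℤ} {i : ℕ} :
    i ∈ columnSlice S L x t ↔ i < L ∧ (x, t + i - x) ∈ S := by
  classical rw [columnSlice, mem_filter, mem_range]

lemma columnSlice_subset_range (S : Set (ℤ × ℤ)) (L : ℕ) (x t : ℤ) :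
    columnSlice S L x t ⊆ range L :=
  fun _ hi => mem_range.2 (mem_columnSlice.1 hi).1

lemma toNat_mem_columnSlice_iff {S : Set (ℤ × ℤ)} {L : ℕ} {t : ℤ} {p : ℤ × ℤ}
    (hp : p.1 + p.2 ∈ Set.Ico t (t + L)) :
    (p.1 + p.2 - t).toNat ∈ columnSlice S L p.1 t ↔ p ∈ S := by
  obtain ⟨h₁, h₂⟩ := hp
  rw [mem_columnSlice, Int.toNat_of_nonneg (by omega), add_sub_cancel, add_sub_cancel_left]
  exact and_iff_right (by omega)

lemma insert_columnSlice_inj {S S' : Set (ℤ × ℤ)} {L : ℕ} {x t : ℤ}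
    (h : insert L (columnSlice S L x t) = insert L (columnSlice S' L x t)) :
    columnSlice S L x t = columnSlice S' L x t := by
  have notMem (S₀) : L ∉ columnSlice S₀ L x t := fun h => (mem_columnSlice.1 h).1.false
  rw [← erase_insert (notMem S), h, erase_insert (notMem _)]

/-- The traces of `S` on the columns over `x₀ + j` and `y₀ + j`, from the line `x + y = t` on, and
on the columns over `x₀ + y₀ + 2 * (e + 1)`, from the line `x + y = 2 * t` on. -/
noncomputable def columnConfig (S : Set (ℤ × ℤ)) (L k : ℕ) (x₀ y₀ t : ℤ) :
    Σ _ : Fin (k + 2) → Finset ℕ × Finset ℕ, Fin k → Finset ℕ :=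
  ⟨fun j => (insert L (columnSlice S L (x₀ + (j : ℕ)) t),
      insert L (columnSlice S L (y₀ + (j : ℕ)) t)),
    fun e => columnSlice S L (x₀ + y₀ + 2 * ((e : ℕ) + 1)) (2 * t)⟩

lemma IsSumFreeSet.notMem_add_of_mem_columnSlice {S : Set (ℤ × ℤ)} (hS : IsSumFreeSet S) {L c : ℕ}
    {x y z t : ℤ} (hz : x + y = z) (hc : c ∈ columnSlice S L z (2 * t)) :
    c ∉ insert L (columnSlice S L x t) + insert L (columnSlice S L y t) := by
  obtain ⟨hcL, hcS⟩ := mem_columnSlice.1 hc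
  intro h
  obtain ⟨a, ha, b, hb, rfl⟩ := mem_add.1 h
  rcases mem_insert.1 ha with rfl | ha
  · omega
  rcases mem_insert.1 hb with rfl | hb
  · omega
  refine hS _ (mem_columnSlice.1 ha).2 _ (mem_columnSlice.1 hb).2 _ hcS (Prod.ext hz ?_)
  rw [Prod.snd_add, ← hz]
  push_cast
  ring

lemma IsSumFreeSet.columnConfig_mem_chainConfigs {S : Set (ℤ × ℤ)} (hS : IsSumFreeSet S) (L k : ℕ)
    (x₀ y₀ t : ℤ) : columnConfig S L k x₀ y₀ t ∈ chainConfigs L k := by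
  have hcapped (x) : insert L (columnSlice S L x t) ∈ cappedSets L :=
    mem_image_of_mem _ (mem_powerset.2 (columnSlice_subset_range S L x t))
  simp only [chainConfigs, mem_sigma, Fintype.mem_piFinset, columnConfig, mem_product, mem_powerset]
  refine ⟨fun j => ⟨hcapped _, hcapped _⟩, fun e c hc => ?_⟩
  simp only [chainFree, mem_sdiff, mem_union, not_or, Fin.val_castSucc, Fin.val_succ]
  refine ⟨columnSlice_subset_range _ _ _ _ hc, ⟨?_, ?_⟩, ?_⟩ <;>
  · refine hS.notMem_add_of_mem_columnSlice ?_ hc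
    push_cast
    ring

/-- The points of the plane whose membership in `S` is recorded by `columnConfig S L k x₀ y₀ t`. -/
def columnCover (L k : ℕ) (x₀ y₀ t : ℤ) : Set (ℤ × ℤ) :=
  {p | p.1 + p.2 ∈ Set.Ico t (t + L) ∧
        (p.1 ∈ Set.Ico x₀ (x₀ + k + 2) ∨ p.1 ∈ Set.Ico y₀ (y₀ + k + 2)) ∨
      p.1 + p.2 ∈ Set.Ico (2 * t) (2 * t + L) ∧ ∃ e < k, p.1 = x₀ + y₀ + 2 * (e + 1)}

lemma exists_fin_add_eq {a x : ℤ} {k : ℕ} (hx : x ∈ Set.Ico a (a + k + 2)) :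
    ∃ j : Fin (k + 2), a + (j : ℕ) = x := by
  obtain ⟨h₁, h₂⟩ := hx
  exact ⟨⟨(x - a).toNat, by omega⟩, by dsimp only; omega⟩

lemma mem_iff_mem_of_columnConfig_eq {S S' : Set (ℤ × ℤ)} {L k : ℕ} {x₀ y₀ t : ℤ}
    (h : columnConfig S L k x₀ y₀ t = columnConfig S' L k x₀ y₀ t) {p : ℤ × ℤ}
    (hp : p ∈ columnCover L k x₀ y₀ t) : p ∈ S ↔ p ∈ S' := by
  simp only [columnConfig, Sigma.mk.injEq, heq_eq_eq, funext_iff, Prod.mk.injEq] at h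
  obtain ⟨hpairs, hmiddle⟩ := h
  rcases hp with ⟨hsum, hx | hx⟩ | ⟨hsum, e, he, hx⟩ <;>
    rw [← toNat_mem_columnSlice_iff hsum, ← toNat_mem_columnSlice_iff hsum]
  · obtain ⟨j, hj⟩ := exists_fin_add_eq hx
    rw [← hj, insert_columnSlice_inj (hpairs j).1]
  · obtain ⟨j, hj⟩ := exists_fin_add_eq hx
    rw [← hj, insert_columnSlice_inj (hpairs j).2]
  · have := hmiddle ⟨e, he⟩
    rw [hx, this]

lemma sumFreeCount_le_of_subset {R : Set (ℤ × ℤ)} {L k : ℕ} {x₀ y₀ x₁ y₁ t : ℤ} (T : Finset (ℤ × ℤ))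
    (hR : R ⊆ columnCover L k x₀ y₀ t ∪ columnCover L k x₁ y₁ t ∪ T) :
    sumFreeCount R ≤ #(chainConfigs L k) * (#(chainConfigs L k) * 2 ^ #T) := by
  classical
  rw [← card_powerset, ← card_product, ← card_product, ← Set.ncard_coe_finset]
  refine Set.ncard_le_ncard_of_injOn (fun S => (columnConfig S L k x₀ y₀ t,
    columnConfig S L k x₁ y₁ t, {p ∈ T | p ∈ S})) ?_ ?_ (finite_toSet _)
  · rintro S ⟨-, hS⟩
    exact mem_product.2 ⟨hS.columnConfig_mem_chainConfigs L k x₀ y₀ t,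
      mem_product.2 ⟨hS.columnConfig_mem_chainConfigs L k x₁ y₁ t,
        mem_powerset.2 (filter_subset _ _)⟩⟩
  · rintro S ⟨hSR, -⟩ S' ⟨hSR', -⟩ h
    simp only [Prod.mk.injEq] at h
    obtain ⟨h₀, h₁, hT⟩ := h
    have mem_iff : ∀ p ∈ R, p ∈ S ↔ p ∈ S' := fun p hp => by
      rcases hR hp with (hp | hp) | hp
      · exact mem_iff_mem_of_columnConfig_eq h₀ hp
      · exact mem_iff_mem_of_columnConfig_eq h₁ hp
      · exact filter_inj'.1 hT (mem_coe.1 hp)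
    ext p
    exact ⟨fun hp => (mem_iff p (hSR hp)).1 hp, fun hp => (mem_iff p (hSR' hp)).2 hp⟩

/-- The pairs of natural numbers with sum in `[a, b)`. -/
def antidiagonalBand (a b : ℕ) : Finset (ℕ × ℕ) := (Ico a b).biUnion antidiagonal

lemma mem_antidiagonalBand {a b : ℕ} {p : ℕ × ℕ} :
    p ∈ antidiagonalBand a b ↔ a ≤ p.1 + p.2 ∧ p.1 + p.2 < b := by
  simp [antidiagonalBand]

lemma two_mul_card_antidiagonalBand_le (a b : ℕ) :
    2 * #(antidiagonalBand a b) ≤ (b - a) * (a + b + 1) := by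
  have hcard : #(antidiagonalBand a b) ≤ ∑ s ∈ Ico a b, (s + 1) :=
    card_biUnion_le.trans_eq (sum_congr rfl fun s _ => Nat.card_antidiagonal s)
  have gauss (b : ℕ) : 2 * ∑ s ∈ Ico a b, (s + 1) = (b - a) * (a + b + 1) := by
    rcases le_total b a with h | h
    · simp [h]
    induction b, h using Nat.le_induction with
    | base => simp
    | succ b h ih =>
      rw [sum_Ico_succ_top h, mul_add, ih, Nat.succ_sub h]
      obtain ⟨d, rfl⟩ := Nat.exists_eq_add_of_le h
      rw [Nat.add_sub_cancel_left, Nat.succ_eq_add_one]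
      ring
  exact (Nat.mul_le_mul_left 2 hcard).trans_eq (gauss b)

/-- A set containing the lattice points of `regionR0 n` which neither of the two chains of columns
meets, where `q = n / 10`: two triangles and a band between two diagonals. -/
def remainder (n q : ℕ) : Finset (ℤ × ℤ) :=
  (antidiagonalBand 0 (2 * q + 10)).image (fun p => ((8 * q + 7 + p.1 : ℤ), (p.2 : ℤ))) ∪
  (antidiagonalBand (2 * n - 14 * q + 1) (2 * n - 10 * q - 16)).image
    (fun p => ((n - p.1 : ℤ), (n - p.2 : ℤ))) ∪
  (antidiagonalBand 0 (2 * q + 11)).image (fun p => ((6 * q + 1 - p.1 : ℤ), (n - p.2 : ℤ)))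

lemma card_remainder_le {n q : ℕ} (hn : n ≤ 10 * q + 9) :
    #(remainder n q) ≤ 36 * q ^ 2 + 88 * q + 121 := by
  have hlower := two_mul_card_antidiagonalBand_le 0 (2 * q + 10)
  have hmiddle := (two_mul_card_antidiagonalBand_le (2 * n - 14 * q + 1)
    (2 * n - 10 * q - 16)).trans
      (Nat.mul_le_mul (show _ ≤ 4 * q by omega) (show _ ≤ 16 * q + 22 by omega))
  have hupper := two_mul_card_antidiagonalBand_le 0 (2 * q + 11)
  have hunion : #(remainder n q) ≤ _ :=
    (card_union_le _ _).trans <| add_le_add ((card_union_le _ _).trans <|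
      add_le_add card_image_le card_image_le) card_image_le
  simp only [Nat.sub_zero] at hlower hupper
  nlinarith

lemma bounds_of_mem_latticePoints_regionR0 {n : ℕ} {p : ℤ × ℤ}
    (hp : p ∈ latticePoints (regionR0 n)) :
    0 ≤ p.1 ∧ p.1 ≤ n ∧ 0 ≤ p.2 ∧ p.2 ≤ n ∧ 7 * n ≤ 10 * (p.1 + p.2) ∧
      10 * (p.1 + p.2) ≤ 17 * n := by
  obtain ⟨⟨hx, hxn⟩, ⟨hy, hyn⟩, hlower, hupper⟩ := hp
  dsimp only at hx hxn hy hyn hlower hupper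
  have hlower' : (7 : ℝ) * n ≤ 10 * (p.1 + p.2) := by linarith
  have hupper' : (10 : ℝ) * (p.1 + p.2) ≤ 17 * n := by linarith
  exact ⟨by exact_mod_cast hx, by exact_mod_cast hxn, by exact_mod_cast hy, by exact_mod_cast hyn,
    by exact_mod_cast hlower', by exact_mod_cast hupper'⟩

lemma mem_union_columnCover_of_lt {q : ℕ} {x y : ℤ} (hx : 0 ≤ x) (hxq : x < 8 * q + 7)
    (hlower : 7 * q ≤ x + y) (hupper : x + y < 10 * q + 17) :
    (x, y) ∈ columnCover (3 * q + 17) (2 * q + 4) (2 * q) (4 * q) (7 * q) ∪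
      columnCover (3 * q + 17) (2 * q + 4) 0 (6 * q + 1) (7 * q) := by
  have hsum : x + y ∈ Set.Ico (7 * q : ℤ) (7 * q + (3 * q + 17 : ℕ)) := by
    push_cast; constructor <;> omega
  have hcolumns : (x ∈ Set.Ico (2 * q : ℤ) (2 * q + (2 * q + 4 : ℕ) + 2) ∨
      x ∈ Set.Ico (4 * q : ℤ) (4 * q + (2 * q + 4 : ℕ) + 2)) ∨
      x ∈ Set.Ico (0 : ℤ) (0 + (2 * q + 4 : ℕ) + 2) ∨
      x ∈ Set.Ico (6 * q + 1 : ℤ) (6 * q + 1 + (2 * q + 4 : ℕ) + 2) := by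
    simp only [Set.mem_Ico]
    omega
  exact hcolumns.imp (fun h => Or.inl ⟨hsum, h⟩) fun h => Or.inl ⟨hsum, h⟩

lemma mem_union_columnCover_of_le {q : ℕ} {x y : ℤ} (hxq : 6 * q + 2 ≤ x) (hx : x ≤ 10 * q + 9)
    (hlower : 14 * q ≤ x + y) (hupper : x + y < 17 * q + 17) :
    (x, y) ∈ columnCover (3 * q + 17) (2 * q + 4) (2 * q) (4 * q) (7 * q) ∪
      columnCover (3 * q + 17) (2 * q + 4) 0 (6 * q + 1) (7 * q) := by
  have hsum : x + y ∈ Set.Ico (2 * (7 * q) : ℤ) (2 * (7 * q) + (3 * q + 17 : ℕ)) := by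
    push_cast; constructor <;> omega
  obtain ⟨e, he | he⟩ := Int.even_or_odd' (x - (6 * q + 2))
  · exact Or.inl (Or.inr ⟨hsum, e.toNat, by omega, by dsimp only; omega⟩)
  · exact Or.inr (Or.inr ⟨hsum, e.toNat, by omega, by dsimp only; omega⟩)

lemma mem_remainder_of_le {n q : ℕ} {x y : ℤ} (hxq : 8 * q + 7 ≤ x) (hy : 0 ≤ y)
    (hupper : x + y < 10 * q + 17) : (x, y) ∈ remainder n q := by
  refine mem_union_left _ (mem_union_left _ (mem_image.2
    ⟨((x - (8 * q + 7)).toNat, y.toNat), mem_antidiagonalBand.2 ?_, Prod.ext ?_ ?_⟩)) <;>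
  · dsimp only
    omega

lemma mem_remainder_of_mem_Ico {n q : ℕ} {x y : ℤ} (hq : 10 * q ≤ n) (hx : x ≤ n) (hy : y ≤ n)
    (hlower : 10 * q + 17 ≤ x + y) (hupper : x + y < 14 * q) : (x, y) ∈ remainder n q := by
  refine mem_union_left _ (mem_union_right _ (mem_image.2
    ⟨((n - x).toNat, (n - y).toNat), mem_antidiagonalBand.2 ?_, Prod.ext ?_ ?_⟩)) <;>
  · dsimp only
    omega

lemma mem_remainder_of_lt {n q : ℕ} {x y : ℤ} (hn : n ≤ 10 * q + 9) (hxq : x < 6 * q + 2)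
    (hy : y ≤ n) (hlower : 14 * q ≤ x + y) : (x, y) ∈ remainder n q := by
  refine mem_union_right _ (mem_image.2
    ⟨((6 * q + 1 - x).toNat, (n - y).toNat), mem_antidiagonalBand.2 ?_, Prod.ext ?_ ?_⟩) <;>
  · dsimp only
    omega

lemma latticePoints_regionR0_subset {n q : ℕ} (hqn : 10 * q ≤ n) (hnq : n ≤ 10 * q + 9) :
    latticePoints (regionR0 n) ⊆
      columnCover (3 * q + 17) (2 * q + 4) (2 * q) (4 * q) (7 * q) ∪
        columnCover (3 * q + 17) (2 * q + 4) 0 (6 * q + 1) (7 * q) ∪ remainder n q := by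
  rintro ⟨x, y⟩ hp
  obtain ⟨hx, hxn, hy, hyn, hlower, hupper⟩ := bounds_of_mem_latticePoints_regionR0 hp
  dsimp only at hx hxn hy hyn hlower hupper
  rcases lt_or_ge (x + y) (10 * q + 17) with hlow | hlow
  · rcases lt_or_ge x (8 * q + 7) with hxq | hxq
    · exact Or.inl (mem_union_columnCover_of_lt hx hxq (by omega) hlow)
    · exact Or.inr (mem_remainder_of_le hxq hy hlow)
  rcases lt_or_ge (x + y) (14 * q) with hhigh | hhigh
  · exact Or.inr (mem_remainder_of_mem_Ico hqn hxn hyn hlow hhigh)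
  rcases lt_or_ge x (6 * q + 2) with hxq | hxq
  · exact Or.inr (mem_remainder_of_lt hnq hxq hyn hhigh)
  · exact Or.inl (mem_union_columnCover_of_le hxq (by omega) hhigh (by omega))

lemma sumFreeCount_latticePoints_regionR0_le {n q : ℕ} (hqn : 10 * q ≤ n) (hnq : n ≤ 10 * q + 9) :
    sumFreeCount (latticePoints (regionR0 n)) ≤ 2 ^ (60 * q ^ 2 + 404 * q + 833) := by
  set E := 2 * (2 * q + 4) * (3 * q + 17) + 8 * (3 * q + 17) + 21 * (2 * q + 4) with hE
  calc _ ≤ #(chainConfigs (3 * q + 17) (2 * q + 4)) *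
          (#(chainConfigs (3 * q + 17) (2 * q + 4)) * 2 ^ #(remainder n q)) :=
        sumFreeCount_le_of_subset _ (latticePoints_regionR0_subset hqn hnq)
    _ ≤ 2 ^ E * (2 ^ E * 2 ^ (36 * q ^ 2 + 88 * q + 121)) := by
        gcongr
        · exact card_chainConfigs_le _ _
        · exact card_chainConfigs_le _ _
        · exact one_le_two
        · exact card_remainder_le hnq
    _ = _ := by
        rw [← pow_add, ← pow_add, hE]
        congr 1
        ring

end

theorem mainTheorem4 :
    ∃ C : ℝ, ∀ n : ℕ, 1 ≤ n →
      (sumFreeCount (latticePoints (regionR0 n)) : ℝ) ≤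
        (2 : ℝ) ^ (0.6 * (n : ℝ) ^ 2 + C * (n : ℝ)) := by
  refine ⟨874, fun n hn => ?_⟩
  set q := n / 10
  have hqn : 10 * q ≤ n := Nat.mul_div_le n 10
  have hexponent : (60 * q ^ 2 + 404 * q + 833 : ℝ) ≤ 0.6 * n ^ 2 + 874 * n := by
    have hqn' : 10 * (q : ℝ) ≤ n := by exact_mod_cast hqn
    have hn' : (1 : ℝ) ≤ n := by exact_mod_cast hn
    nlinarith [q.cast_nonneg (α := ℝ)]
  calc (sumFreeCount (latticePoints (regionR0 n)) : ℝ)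
      ≤ 2 ^ (60 * q ^ 2 + 404 * q + 833) := by
        exact_mod_cast sumFreeCount_latticePoints_regionR0_le hqn (by omega)
    _ = (2 : ℝ) ^ (60 * q ^ 2 + 404 * q + 833 : ℝ) := by exact_mod_cast (Real.rpow_natCast 2 _).symm
    _ ≤ _ := Real.rpow_le_rpow_of_exponent_le one_le_two hexponent
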